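/- Let $H$ be an infinite-dimensional complex Hilbert space. For a bounded operator $T$ on $H$ put $s_n(T)=\inf\{\|T-F\|:\operatorname{rank}F\le n\}$, $n\ge0$, and let $\|T\|_{S_p}=\big(\sum_{n\ge0}s_n(T)^p\big)^{1/p}$ for $1\le p<\infty$ and $\|T\|_{S_\infty}=\|T\|$. For finite rank self-adjoint operators $A,B,C$ on $H$ and a function $f:\mathbb R^3\to\mathbb C$ put $$f(A,B,C)=\sum_{\lambda\in\sigma(A),\,\mu\in\sigma(B),\,\nu\in\sigma(C)}f(\lambda,\mu,\nu)\,E_A(\{\lambda\})E_B(\{\mu\})E_C(\{\nu\}),$$ where $E_A$, $E_B$, $E_C$ are the spectral measures of $A$, $B$, $C$. Let $w\in C^\infty(\mathbb R)$ satisfy $w\ge0$, $\operatorname{supp}w\subset[\frac12,2]$ and $w(s)=1-w(s/2)$ for $s\in[1,2]$, and for $n\in\mathbb Z$ let $W_n$ be the Schwartz function on $\mathbb R^d$ with $\int_{\mathbb R^d}W_n(x)e^{-i(x,t)}\,dx=w(2^{-n}\|t\|_2)$ for all $t\in\mathbb R^d$. For a tempered distribution $f$ on $\mathbb R^d$ let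 $f_n=f*W_n$ and $$\|f\|_{B^1_{\infty,1}(\mathbb R^d)}=\sum_{n\in\mathbb Z}2^n\|f_n\|_{L^\infty}.$$ The class $B^1_{\infty,1}(\mathbb R^d)$ consists of the tempered distributions $f$ for which this sum is finite and $\frac{\partial f}{\partial x_j}=\sum_{n\in\mathbb Z}\frac{\partial f_n}{\partial x_j}$ in the weak-$*$ topology of $\mathscr S'(\mathbb R^d)$ for $1\le j\le d$; its elements are continuous functions. Theorem. Let $p\in[1,\infty]$. There is no constant $K>0$ such that $$\|f(A_1,B_1,C_1)-f(A_2,B_2,C_2)\|_{S_p}\le K\,\|f\|_{B^1_{\infty,1}(\mathbb R^3)}\max\big\{\|A_1-A_2\|_{S_p},\|B_1-B_2\|_{S_p},\|C_1-C_2\|_{S_p}\big\}$$ for all triples $(A_1,B_1,C_1)$ and $(A_2,B_2,C_2)$ of not necessarily commuting finite rank self-adjoint operators on $H$ and all functions $f$ in $B^1_{\infty,1}(\mathbb R^3)$. -/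

import Mathlib

open MeasureTheory
open scoped ENNReal SchwartzMap ContDiff FourierTransform LineDeriv

noncomputable section

namespace TripleLip

/-! ### Schatten–von Neumann norms -/

section Operators

variable {H : Type*} [NormedAddCommGroup H] [InnerProductSpace ℂ H]

/-- The `n`-th singular value (`n = 0, 1, …`) of a bounded operator on a Hilbert space: the distance
in operator norm from `T` to the operators of rank at most `n`. -/
def singularValue (T : H →L[ℂ] H) (n : ℕ) : ℝ≥0∞ :=
  ⨅ (F : H →L[ℂ] H) (_ : LinearMap.rank (F : H →ₗ[ℂ] H) ≤ (n : Cardinal)), ‖T - F‖ₑ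

/-- The norm of the Schatten–von Neumann class `S_p`: the `ℓ^p` norm of the sequence of singular
values for `p < ∞`, and the operator norm for `p = ∞`. -/
def schattenNorm (p : ℝ≥0∞) (T : H →L[ℂ] H) : ℝ≥0∞ :=
  if p = ⊤ then ‖T‖ₑ else (∑' n, singularValue T n ^ p.toReal) ^ (1 / p.toReal)

variable [CompleteSpace H]

/-- Finite rank self-adjoint operators. -/
structure IsFiniteRankSelfAdjoint (A : H →L[ℂ] H) : Prop where
  isSelfAdjoint : IsSelfAdjoint A
  finiteRank : FiniteDimensional ℂ (LinearMap.range (A : H →ₗ[ℂ] H))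

/-- The value `E_A({a})` of the spectral measure of a self-adjoint operator `A` at a one-point set:
the orthogonal projection onto `ker (A - a I)`. -/
def spectralProj (A : H →L[ℂ] H) (a : ℝ) : H →L[ℂ] H :=
  (A - (a : ℂ) • (1 : H →L[ℂ] H)).ker.starProjection

/-- `f(A, B, C) = ∑ f(a, b, c) E_A({a}) E_B({b}) E_C({c})`, the sum being over `a ∈ σ(A)`,
`b ∈ σ(B)`, `c ∈ σ(C)`, for self-adjoint operators with finite spectra. -/
def tripleFun (f : EuclideanSpace ℝ (Fin 3) → ℂ) (A B C : H →L[ℂ] H) : H →L[ℂ] H :=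
  ∑ᶠ (a ∈ spectrum ℝ A) (b ∈ spectrum ℝ B) (c ∈ spectrum ℝ C),
    f !₂[a, b, c] • (spectralProj A a * spectralProj B b * spectralProj C c)

end Operators

/-! ### The Besov class `B^1_{∞,1}(ℝ^d)` -/

/-- The functions `w` generating a Littlewood–Paley decomposition. -/
structure DyadicBump where
  w : ℝ → ℝ
  smooth : ContDiff ℝ ∞ w
  nonneg : ∀ s, 0 ≤ w s
  supp : tsupport w ⊆ Set.Icc (1 / 2) 2
  partition : ∀ s ∈ Set.Icc (1 : ℝ) 2, w s = 1 - w (s / 2)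

instance : Nonempty DyadicBump := by
  refine ⟨⟨fun s => Real.smoothTransition (2 - s) - Real.smoothTransition (2 - 2 * s),
    ?_, ?_, ?_, ?_⟩⟩
  · exact (Real.smoothTransition.contDiff.comp (by fun_prop)).sub
      (Real.smoothTransition.contDiff.comp (by fun_prop))
  · intro s
    rcases le_total s 0 with h | h
    · rw [Real.smoothTransition.one_of_one_le (by linarith),
        Real.smoothTransition.one_of_one_le (by linarith)]
      simp
    · exact sub_nonneg.2 (Real.smoothTransition.monotone (by linarith))
  · refine closure_minimal ?_ isClosed_Icc
    intro s hs
    by_contra hn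
    apply hs
    rw [Set.mem_Icc, not_and_or, not_le, not_le] at hn
    rcases hn with h | h
    · simp [Real.smoothTransition.one_of_one_le (show (1 : ℝ) ≤ 2 - s by linarith),
        Real.smoothTransition.one_of_one_le (show (1 : ℝ) ≤ 2 - 2 * s by linarith)]
    · simp [Real.smoothTransition.zero_of_nonpos (show 2 - s ≤ 0 by linarith),
        Real.smoothTransition.zero_of_nonpos (show 2 - 2 * s ≤ 0 by linarith)]
  · rintro s ⟨h1, h2⟩
    rw [Real.smoothTransition.zero_of_nonpos (show 2 - 2 * s ≤ 0 by linarith),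
      Real.smoothTransition.one_of_one_le (show (1 : ℝ) ≤ 2 - s / 2 by linarith),
      show 2 - 2 * (s / 2) = 2 - s by ring]
    ring

section Besov

variable {d : ℕ}

/-- `ξ ↦ w (‖2πξ‖ / 2^n)`. -/
def lpSymbolFun (w : DyadicBump) (n : ℤ) (ξ : EuclideanSpace ℝ (Fin d)) : ℂ :=
  (w.w (‖(2 * Real.pi) • ξ‖ / 2 ^ n) : ℂ)

theorem lpSymbolFun_contDiff (w : DyadicBump) (n : ℤ) :
    ContDiff ℝ ∞ (lpSymbolFun (d := d) w n) := by
  have h2 : (0 : ℝ) < 2 ^ n := by positivity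
  rw [contDiff_iff_contDiffAt]
  intro x
  by_cases hx : x = 0
  · have : lpSymbolFun (d := d) w n =ᶠ[nhds x] fun _ => 0 := by
      have hc : Continuous fun ξ : EuclideanSpace ℝ (Fin d) => ‖(2 * Real.pi) • ξ‖ / 2 ^ n := by
        fun_prop
      have : ∀ᶠ ξ in nhds x, ‖(2 * Real.pi) • ξ‖ / 2 ^ n < 1 / 2 :=
        hc.continuousAt.eventually_lt continuousAt_const (by simp [hx])
      filter_upwards [this] with ξ hξ
      have : w.w (‖(2 * Real.pi) • ξ‖ / 2 ^ n) = 0 :=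
        image_eq_zero_of_notMem_tsupport fun h => absurd (w.supp h).1 (not_le.2 hξ)
      simp [lpSymbolFun, this]
    exact contDiffAt_const.congr_of_eventuallyEq this
  · have hx' : (2 * Real.pi) • x ≠ 0 := smul_ne_zero (by positivity) hx
    have h1 : ContDiffAt ℝ ∞ (fun ξ : EuclideanSpace ℝ (Fin d) => ‖(2 * Real.pi) • ξ‖ / 2 ^ n) x :=
      (ContDiffAt.norm ℝ (f := fun ξ : EuclideanSpace ℝ (Fin d) => (2 * Real.pi) • ξ)
        (contDiff_const_smul (2 * Real.pi)).contDiffAt hx').div_const _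
    exact Complex.ofRealCLM.contDiff.contDiffAt.comp x (w.smooth.contDiffAt.comp x h1)

theorem lpSymbolFun_hasCompactSupport (w : DyadicBump) (n : ℤ) :
    HasCompactSupport (lpSymbolFun (d := d) w n) := by
  have h2 : (0 : ℝ) < 2 ^ n := by positivity
  refine HasCompactSupport.intro (isCompact_closedBall (0 : EuclideanSpace ℝ (Fin d)) (2 * 2 ^ n)) ?_
  intro ξ hξ
  have hξ' : 2 * 2 ^ n < ‖ξ‖ := by simpa using hξ
  have : w.w (‖(2 * Real.pi) • ξ‖ / 2 ^ n) = 0 := by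
    refine image_eq_zero_of_notMem_tsupport fun h => ?_
    have h3 := (div_le_iff₀ h2).1 (w.supp h).2
    rw [norm_smul, Real.norm_of_nonneg (by positivity)] at h3
    nlinarith [Real.pi_gt_three, norm_nonneg ξ]
  simp [lpSymbolFun, this]

/-- The Schwartz function `W_n` with `∫ W_n(x) e^{-i(x,t)} dx = w(‖t‖ / 2^n)`. Mathlib's Fourier
transform has the kernel `e^{-2πi(x,ξ)}`, so that `t = 2πξ`. -/
def lpKernel (w : DyadicBump) (n : ℤ) : 𝓢(EuclideanSpace ℝ (Fin d), ℂ) :=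
  𝓕⁻ ((lpSymbolFun_hasCompactSupport w n).toSchwartzMap (lpSymbolFun_contDiff w n))

/-- The convolution `T * W` of a tempered distribution with a Schwartz function:
`⟨T * W, u⟩ = ⟨T, W(-·) * u⟩`. -/
def distConv (T : 𝓢'(EuclideanSpace ℝ (Fin d), ℂ)) (W : 𝓢(EuclideanSpace ℝ (Fin d), ℂ)) :
    𝓢'(EuclideanSpace ℝ (Fin d), ℂ) :=
  ContinuousLinearMap.toPointwiseConvergenceCLM _ _ _ _
    ((show 𝓢(EuclideanSpace ℝ (Fin d), ℂ) →L[ℂ] ℂ from T) ∘L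
      SchwartzMap.convolution (ContinuousLinearMap.mul ℂ ℂ)
        (SchwartzMap.compCLMOfContinuousLinearEquiv ℂ
          (ContinuousLinearEquiv.neg ℝ : EuclideanSpace ℝ (Fin d) ≃L[ℝ] _) W))

/-- The `L^∞` norm of a tempered distribution, equal to `∞` if it is not given by an
`L^∞` function. -/
def linftyNorm (S : 𝓢'(EuclideanSpace ℝ (Fin d), ℂ)) : ℝ≥0∞ :=
  ⨅ (g : Lp ℂ (⊤ : ℝ≥0∞) (volume : Measure (EuclideanSpace ℝ (Fin d))))
    (_ : Lp.toTemperedDistribution g = S), ‖g‖ₑ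

/-- The (semi)norm of `B^1_{∞,1}(ℝ^d)`: `∑_{n ∈ ℤ} 2^n ‖T * W_n‖_{L^∞}`. -/
def besovNorm (w : DyadicBump) (T : 𝓢'(EuclideanSpace ℝ (Fin d), ℂ)) : ℝ≥0∞ :=
  ∑' n : ℤ, (2 : ℝ≥0∞) ^ n * linftyNorm (distConv T (lpKernel w n))

/-- The (modified homogeneous) Besov class `B^1_{∞,1}(ℝ^d)`. The topology of Mathlib's space of
tempered distributions is the weak-* topology. -/
structure MemBesov (w : DyadicBump) (T : 𝓢'(EuclideanSpace ℝ (Fin d), ℂ)) : Prop where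
  norm_ne_top : besovNorm w T ≠ ⊤
  hasSum_deriv : ∀ j : Fin d,
    HasSum (fun n : ℤ => ∂_{EuclideanSpace.single j (1 : ℝ)} (distConv T (lpKernel w n)))
      (∂_{EuclideanSpace.single j (1 : ℝ)} T)

/-- The continuous function `f` is (the continuous representative of) the tempered
distribution `T`. -/
structure IsContinuousRepr (f : EuclideanSpace ℝ (Fin d) → ℂ)
    (T : 𝓢'(EuclideanSpace ℝ (Fin d), ℂ)) : Prop where
  continuous : Continuous f
  integrable : ∀ u : 𝓢(EuclideanSpace ℝ (Fin d), ℂ), Integrable fun x => u x * f x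
  apply_eq : ∀ u : 𝓢(EuclideanSpace ℝ (Fin d), ℂ), T u = ∫ x, u x * f x

end Besov

end TripleLip

end

open TripleLip

/-! The obstruction is a family of functions `chirp M`, bounded by 1 and with frequencies in a ball
independent of `M`, so that their Besov norms stay bounded, although they act on suitable triples
with a gain of order `√M`.

Let `e` be an orthonormal family indexed by `ZMod M`, `q` its discrete Fourier transform and `χ` the
standard additive character. Take `A` diagonal in `q` with eigenvalues `j + 1`, and `B₁`, `B₂`
diagonal in `e` with eigenvalues `m + 1` and `m + 3/2`. Then `B₁ - B₂` is `-1/2` times a projection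
of rank `M`. In the basis `q`, the matrix of `f(A, B₁, A)` has entries `M⁻¹ ∑ₘ f(j + 1, m + 1, k +
1) χ((k - j)m)`. The choice `f = χ(jk) χ((j - k)m)` on these points cancels the oscillation in `m`
and leaves `χ(jk)`, which is `√M` times a unitary matrix. If moreover `f` vanishes on the points
with middle coordinate `m + 3/2`, then `f(A, B₂, A)` is zero on the span of `q`. Both differences
are thus comparable to multiples of rank `M` partial isometries. The factor `M^(1/p)` appears on
both sides and cancels, so a constant `K` would bound `√M` for all `M`, whatever `p` is.

It remains to extend `f` to `ℝ³` (`norm_chirp_le`, `norm_chirpFreq_le`). In the outer variables,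
translates of a normalized Fejér kernel interpolate without increasing the sup norm, being
nonnegative with sum 1. In the middle variable the phase has frequency `(j - k)/M`, which is at most
1 in modulus. The factor `(1 + e^{2πit})/2` is 1 at integers and 0 at half-integers. The result is a
trigonometric polynomial, for which the Besov norm is estimated directly (`besovNorm_trigDist_le`).
-/

noncomputable section

namespace TripleLip

/-! ### Upper and lower bounds for Schatten norms. -/

section Schatten

variable {H : Type*} [NormedAddCommGroup H] [InnerProductSpace ℂ H]

/-- The Schatten `p`-norm of the identity of an `m`-dimensional space. -/
def schattenDim (p : ℝ≥0∞) (m : ℕ) : ℝ≥0∞ :=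
  if p = ⊤ then 1 else (m : ℝ≥0∞) ^ (1 / p.toReal)

theorem schattenDim_ne_zero (p : ℝ≥0∞) {m : ℕ} (hm : m ≠ 0) : schattenDim p m ≠ 0 := by
  unfold schattenDim
  split_ifs
  · simp
  · have : (0 : ℝ≥0∞) < (m : ℝ≥0∞) ^ (1 / p.toReal) :=
      ENNReal.rpow_pos (by simpa using Nat.pos_of_ne_zero hm) (by simp)
    exact this.ne'

theorem schattenDim_ne_top (p : ℝ≥0∞) (m : ℕ) : schattenDim p m ≠ ⊤ := by
  unfold schattenDim
  split_ifs
  · simp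
  · exact ENNReal.rpow_ne_top_of_nonneg (by positivity) (by simp)

theorem singularValue_le_enorm (T : H →L[ℂ] H) (n : ℕ) : singularValue T n ≤ ‖T‖ₑ := by
  refine (iInf₂_le (0 : H →L[ℂ] H) ?_).trans (by simp)
  simp

theorem singularValue_eq_zero {T : H →L[ℂ] H} {n : ℕ}
    (hT : LinearMap.rank (T : H →ₗ[ℂ] H) ≤ (n : Cardinal)) : singularValue T n = 0 :=
  le_antisymm ((iInf₂_le T hT).trans (by simp [enorm_eq_nnnorm])) zero_le

theorem schattenNorm_le_of_rank_le {p : ℝ≥0∞} (hp : 1 ≤ p) {T : H →L[ℂ] H} {m : ℕ}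
    (hT : LinearMap.rank (T : H →ₗ[ℂ] H) ≤ (m : Cardinal)) :
    schattenNorm p T ≤ ‖T‖ₑ * schattenDim p m := by
  unfold schattenNorm schattenDim
  split_ifs with h
  · simp
  have hp0 : 0 < p.toReal := ENNReal.toReal_pos (zero_lt_one.trans_le hp).ne' h
  have hsum : ∑' n, singularValue T n ^ p.toReal ≤ m * ‖T‖ₑ ^ p.toReal := by
    rw [tsum_eq_sum (s := Finset.range m)]
    · refine (Finset.sum_le_card_nsmul _ _ (‖T‖ₑ ^ p.toReal) fun n _ => ?_).trans (by simp)
      exact ENNReal.rpow_le_rpow (singularValue_le_enorm T n) hp0.le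
    · intro n hn
      rw [Finset.mem_range, not_lt] at hn
      rw [singularValue_eq_zero (hT.trans (by exact_mod_cast hn)), ENNReal.zero_rpow_of_pos hp0]
  refine (ENNReal.rpow_le_rpow hsum (by positivity)).trans ?_
  rw [ENNReal.mul_rpow_of_nonneg _ _ (by positivity), ← ENNReal.rpow_mul,
    mul_one_div_cancel hp0.ne', ENNReal.rpow_one, mul_comm]

theorem norm_sum_smul_orthonormal_eq {ι : Type*} [Fintype ι] {q g : ι → H}
    (hq : Orthonormal ℂ q) (hg : Orthonormal ℂ g) (y : ι → ℂ) :
    ‖∑ i, y i • q i‖ = ‖∑ i, y i • g i‖ := by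
  have h : ∀ {v : ι → H}, Orthonormal ℂ v → ‖∑ i, y i • v i‖ ^ 2 = ∑ i, ‖y i‖ ^ 2 := by
    intro v hv
    have := hv.inner_sum y y Finset.univ
    rw [inner_self_eq_norm_sq_to_K] at this
    have h2 : ((‖∑ i, y i • v i‖ ^ 2 : ℝ) : ℂ) = ((∑ i, ‖y i‖ ^ 2 : ℝ) : ℂ) := by
      push_cast
      refine this.trans (Finset.sum_congr rfl fun i _ => ?_)
      rw [mul_comm, Complex.mul_conj, Complex.normSq_eq_norm_sq]
      simp
    exact_mod_cast h2
  have := (h hq).trans (h hg).symm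
  exact (pow_left_inj₀ (norm_nonneg _) (norm_nonneg _) two_ne_zero).1 this

/-- By a dimension count, an operator `F` of rank at most `n` kills some nonzero `x` in the span of
the `q i`. There `T` is `c` times an isometry, so `‖(T - F) x‖ = ‖c‖ ‖x‖`. -/
theorem le_singularValue_of_orthonormal {ι : Type*} [Fintype ι] {T : H →L[ℂ] H} {q g : ι → H}
    (hq : Orthonormal ℂ q) (hg : Orthonormal ℂ g) {c : ℂ} (hT : ∀ i, T (q i) = c • g i)
    {n : ℕ} (hn : n < Fintype.card ι) : ‖c‖ₑ ≤ singularValue T n := by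
  refine le_iInf₂ fun F hF => ?_
  have hfin : Module.Finite ℂ (LinearMap.range (F : H →ₗ[ℂ] H)) :=
    Module.rank_lt_aleph0_iff.1 (hF.trans_lt (Cardinal.natCast_lt_aleph0))
  have hrank : Module.finrank ℂ (LinearMap.range (F : H →ₗ[ℂ] H)) ≤ n :=
    Module.finrank_le_of_rank_le hF
  let L : (ι → ℂ) →ₗ[ℂ] LinearMap.range (F : H →ₗ[ℂ] H) :=
    (F : H →ₗ[ℂ] H).rangeRestrict ∘ₗ Fintype.linearCombination ℂ q
  have hker : LinearMap.ker L ≠ ⊥ :=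
    LinearMap.ker_ne_bot_of_finrank_lt (by rw [Module.finrank_fintype_fun_eq_card]; omega)
  obtain ⟨y, hy, hy0⟩ := (Submodule.ne_bot_iff _).1 hker
  set x := ∑ i, y i • q i with hx
  have hFx : F x = 0 := by
    have := congrArg Subtype.val (LinearMap.mem_ker.1 hy)
    simpa [L, Fintype.linearCombination_apply, hx] using this
  have hx0 : x ≠ 0 := by
    intro h
    refine hy0 (funext fun i => ?_)
    exact Fintype.linearIndependent_iff.1 hq.linearIndependent y h i
  have hTx : T x = c • ∑ i, y i • g i := by
    rw [hx, map_sum, Finset.smul_sum]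
    refine Finset.sum_congr rfl fun i _ => ?_
    rw [map_smul, hT, smul_comm]
  have hle := (T - F).le_opNorm x
  rw [sub_apply, hFx, sub_zero, hTx, norm_smul, ← norm_sum_smul_orthonormal_eq hq hg,
    ← hx] at hle
  have := le_of_mul_le_mul_right hle (norm_pos_iff.2 hx0)
  rwa [enorm_le_iff_norm_le]

theorem le_schattenNorm_of_orthonormal {ι : Type*} [Fintype ι] [Nonempty ι] {p : ℝ≥0∞}
    (hp : 1 ≤ p) {T : H →L[ℂ] H} {q g : ι → H}
    (hq : Orthonormal ℂ q) (hg : Orthonormal ℂ g) {c : ℂ} (hT : ∀ i, T (q i) = c • g i) :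
    ‖c‖ₑ * schattenDim p (Fintype.card ι) ≤ schattenNorm p T := by
  unfold schattenNorm schattenDim
  split_ifs with h
  · rw [mul_one]
    exact (le_singularValue_of_orthonormal hq hg hT Fintype.card_pos).trans
      (singularValue_le_enorm T 0)
  have hp0 : 0 < p.toReal := ENNReal.toReal_pos (zero_lt_one.trans_le hp).ne' h
  have hsum : (Fintype.card ι : ℝ≥0∞) * ‖c‖ₑ ^ p.toReal ≤ ∑' n, singularValue T n ^ p.toReal := by
    refine le_trans ?_ (ENNReal.sum_le_tsum (Finset.range (Fintype.card ι)))
    refine le_trans ?_ (Finset.card_nsmul_le_sum _ _ (‖c‖ₑ ^ p.toReal) fun n hn => ?_)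
    · simp
    · exact ENNReal.rpow_le_rpow
        (le_singularValue_of_orthonormal hq hg hT (Finset.mem_range.1 hn)) hp0.le
  refine le_trans ?_ (ENNReal.rpow_le_rpow hsum (by positivity))
  rw [ENNReal.mul_rpow_of_nonneg _ _ (by positivity), ← ENNReal.rpow_mul,
    mul_one_div_cancel hp0.ne', ENNReal.rpow_one, mul_comm]

theorem mem_ker_sub_smul_one_iff {A : H →L[ℂ] H} {x : ℝ} {y : H} :
    y ∈ (A - (x : ℂ) • (1 : H →L[ℂ] H)).ker ↔ A y = (x : ℂ) • y := by
  rw [LinearMap.mem_ker]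
  simp [sub_eq_zero]

end Schatten

/-! ### Evaluation of `tripleFun` from explicit spectral decompositions. -/

section Spectral

variable {H : Type*} [NormedAddCommGroup H] [InnerProductSpace ℂ H] [CompleteSpace H]

/-- `A = ∑ a_i P_i` is the spectral decomposition of a self-adjoint operator with finite
spectrum. -/
structure IsSpectralResolution {κ : Type*} [Fintype κ] (A : H →L[ℂ] H) (P : κ → H →L[ℂ] H)
    (a : κ → ℝ) : Prop where
  proj : ∀ i, IsStarProjection (P i)
  orthogonal : ∀ i j, i ≠ j → P i * P j = 0
  sum_eq_one : ∑ i, P i = 1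
  injective : Function.Injective a
  eq_sum : A = ∑ i, (a i : ℂ) • P i

namespace IsSpectralResolution

variable {κ : Type*} [Fintype κ] {A : H →L[ℂ] H} {P : κ → H →L[ℂ] H} {a : κ → ℝ}

theorem proj_mul (h : IsSpectralResolution A P a) (i : κ) : P i * A = (a i : ℂ) • P i := by
  classical
  rw [h.eq_sum, Finset.mul_sum, Finset.sum_eq_single i]
  · rw [mul_smul_comm, (h.proj i).isIdempotentElem]
  · intro j _ hj
    rw [mul_smul_comm, h.orthogonal i j hj.symm, smul_zero]
  · simp

theorem mul_proj (h : IsSpectralResolution A P a) (i : κ) : A * P i = (a i : ℂ) • P i := by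
  classical
  rw [h.eq_sum, Finset.sum_mul, Finset.sum_eq_single i]
  · rw [smul_mul_assoc, (h.proj i).isIdempotentElem]
  · intro j _ hj
    rw [smul_mul_assoc, h.orthogonal j i hj, smul_zero]
  · simp

theorem proj_apply_eq_zero (h : IsSpectralResolution A P a) {x : ℝ} {y : H}
    (hy : A y = (x : ℂ) • y) {i : κ} (hi : a i ≠ x) : P i y = 0 := by
  have h1 : P i (A y) = (a i : ℂ) • P i y := by
    have := congrArg (fun S : H →L[ℂ] H => S y) (h.proj_mul i)
    simpa using this
  rw [hy, map_smul, ← sub_eq_zero, ← sub_smul, smul_eq_zero, sub_eq_zero] at h1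
  exact h1.resolve_left (by exact_mod_cast hi.symm)

theorem apply_eq_sum (h : IsSpectralResolution A P a) (y : H) : y = ∑ i, P i y := by
  have := congrArg (fun S : H →L[ℂ] H => S y) h.sum_eq_one
  simpa using this.symm

theorem spectralProj_eq (h : IsSpectralResolution A P a) (i : κ) :
    spectralProj A (a i) = P i := by
  obtain ⟨hproj, hP⟩ := isStarProjection_iff_eq_starProjection_range.1 (h.proj i)
  have hker : (A - (a i : ℂ) • (1 : H →L[ℂ] H)).ker = (P i).range := by
    ext y
    rw [mem_ker_sub_smul_one_iff]
    constructor
    · intro hy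
      refine ⟨y, ?_⟩
      conv_rhs => rw [h.apply_eq_sum y]
      exact (Fintype.sum_eq_single i fun j hj =>
        h.proj_apply_eq_zero hy (h.injective.ne hj)).symm
    · rintro ⟨z, rfl⟩
      have := congrArg (fun S : H →L[ℂ] H => S z) (h.mul_proj i)
      simpa using this
  unfold spectralProj
  rw [hP]
  congr 1

theorem spectralProj_eq_zero (h : IsSpectralResolution A P a) {x : ℝ} (hx : x ∉ Set.range a) :
    spectralProj A x = 0 := by
  have hker : (A - (x : ℂ) • (1 : H →L[ℂ] H)).ker = ⊥ := by
    rw [Submodule.eq_bot_iff]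
    intro y hy
    rw [mem_ker_sub_smul_one_iff] at hy
    rw [h.apply_eq_sum y]
    exact Finset.sum_eq_zero fun i _ => h.proj_apply_eq_zero hy fun hi => hx ⟨i, hi⟩
  unfold spectralProj
  have h0 : ((⊥ : Submodule ℂ H)).starProjection = 0 := by ext; simp
  simp only [hker, h0]

end IsSpectralResolution

theorem spectralProj_eq_zero_of_notMem_spectrum {A : H →L[ℂ] H} {x : ℝ}
    (hx : x ∉ spectrum ℝ A) : spectralProj A x = 0 := by
  have hu : IsUnit (algebraMap ℝ (H →L[ℂ] H) x - A) := spectrum.notMem_iff.1 hx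
  have hker : (A - (x : ℂ) • (1 : H →L[ℂ] H)).ker = ⊥ := by
    rw [Submodule.eq_bot_iff]
    intro y hy
    rw [mem_ker_sub_smul_one_iff] at hy
    obtain ⟨u, hu⟩ := hu
    have h0 : (u : H →L[ℂ] H) y = 0 := by
      rw [hu, Algebra.algebraMap_eq_smul_one]
      simp [hy]
    calc y = ((↑u⁻¹ : H →L[ℂ] H) * u) y := by rw [u.inv_mul]; rfl
      _ = (↑u⁻¹ : H →L[ℂ] H) ((u : H →L[ℂ] H) y) := rfl
      _ = 0 := by rw [h0, map_zero]
  unfold spectralProj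
  have h0 : ((⊥ : Submodule ℂ H)).starProjection = 0 := by ext; simp
  simp only [hker, h0]

/-- The spectrum need not be computed: off the spectrum, and off the range of `a`, the spectral
projection vanishes and so does `g`. In particular some `P i` may be zero. -/
theorem IsSpectralResolution.finsum_mem_spectrum {κ V : Type*} [Fintype κ] [AddCommMonoid V]
    {A : H →L[ℂ] H} {P : κ → H →L[ℂ] H} {a : κ → ℝ} (h : IsSpectralResolution A P a)
    (g : ℝ → V) (hg : ∀ x, spectralProj A x = 0 → g x = 0) :
    ∑ᶠ x ∈ spectrum ℝ A, g x = ∑ i, g (a i) := by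
  have h1 : ∑ᶠ x ∈ spectrum ℝ A, g x = ∑ᶠ x, g x := by
    refine finsum_congr fun x => ?_
    by_cases hx : x ∈ spectrum ℝ A
    · simp [hx]
    · rw [hg x (spectralProj_eq_zero_of_notMem_spectrum hx)]
      simp
  rw [h1, finsum_eq_sum_of_support_subset (s := Finset.univ.map ⟨a, h.injective⟩)]
  · simp
  · intro x hx
    by_contra hn
    refine hx (hg x (h.spectralProj_eq_zero fun ⟨i, hi⟩ => hn ?_))
    simp [← hi]

theorem tripleFun_eq_sum {κ₁ κ₂ κ₃ : Type*} [Fintype κ₁] [Fintype κ₂] [Fintype κ₃]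
    {A B C : H →L[ℂ] H} {P : κ₁ → H →L[ℂ] H} {Q : κ₂ → H →L[ℂ] H} {R : κ₃ → H →L[ℂ] H}
    {a : κ₁ → ℝ} {b : κ₂ → ℝ} {c : κ₃ → ℝ} (hA : IsSpectralResolution A P a)
    (hB : IsSpectralResolution B Q b) (hC : IsSpectralResolution C R c)
    (f : EuclideanSpace ℝ (Fin 3) → ℂ) :
    tripleFun f A B C = ∑ i, ∑ j, ∑ k, f !₂[a i, b j, c k] • (P i * Q j * R k) := by
  unfold tripleFun
  rw [hA.finsum_mem_spectrum]
  · refine Finset.sum_congr rfl fun i _ => ?_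
    rw [hB.finsum_mem_spectrum]
    · refine Finset.sum_congr rfl fun j _ => ?_
      rw [hC.finsum_mem_spectrum]
      · simp only [hA.spectralProj_eq, hB.spectralProj_eq, hC.spectralProj_eq]
      · intro x hx
        simp [hx]
    · intro x hx
      simp [hx]
  · intro x hx
    simp [hx]

end Spectral

/-! ### The Littlewood–Paley partition and the scaling of its kernels. -/

section LittlewoodPaley

variable {d : ℕ}

theorem DyadicBump.eq_zero_of_lt (w : DyadicBump) {s : ℝ} (hs : s < 1 / 2) : w.w s = 0 :=
  image_eq_zero_of_notMem_tsupport fun h => absurd (w.supp h).1 (not_le.2 hs)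

theorem DyadicBump.eq_zero_of_ge (w : DyadicBump) {s : ℝ} (hs : 2 ≤ s) : w.w s = 0 := by
  have h : Set.EqOn w.w (fun _ => 0) (Set.Ioi 2) := fun x hx =>
    image_eq_zero_of_notMem_tsupport fun h => absurd (w.supp h).2 (not_le.2 hx)
  -- The endpoint 2 may lie in the topological support; the value there is 0 by continuity.
  have h2 := h.closure w.smooth.continuous continuous_const
  rw [closure_Ioi] at h2
  exact h2 hs

/-- If `2^m ≤ t < 2^(m+1)`, only `n = m` and `n = m + 1` contribute, and these two terms add up to 1
by `partition`. -/
theorem DyadicBump.hasSum_zpow (w : DyadicBump) {t : ℝ} (ht : 0 < t) :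
    HasSum (fun n : ℤ => w.w (t / 2 ^ n)) 1 := by
  obtain ⟨m, hm1, hm2⟩ := exists_mem_Ico_zpow ht (one_lt_two (α := ℝ))
  have hpos : ∀ n : ℤ, (0 : ℝ) < 2 ^ n := fun n => by positivity
  have hsum : ∑ n ∈ ({m, m + 1} : Finset ℤ), w.w (t / 2 ^ n) = 1 := by
    rw [Finset.sum_pair (by simp)]
    have h1 : (1 : ℝ) ≤ t / 2 ^ m := (one_le_div (hpos m)).2 hm1
    have h2 : t / 2 ^ m ≤ 2 := by
      rw [div_le_iff₀ (hpos m)]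
      rw [zpow_add_one₀ two_ne_zero] at hm2
      linarith
    have := w.partition _ ⟨h1, h2⟩
    rw [this, zpow_add_one₀ two_ne_zero, div_div]
    ring
  rw [← hsum]
  refine hasSum_sum_of_ne_finset_zero fun n hn => ?_
  simp only [Finset.mem_insert, Finset.mem_singleton, not_or] at hn
  rcases lt_or_ge n m with h | h
  · refine w.eq_zero_of_ge ((le_div_iff₀ (hpos n)).2 (le_trans ?_ hm1))
    rw [mul_comm, ← zpow_add_one₀ two_ne_zero]
    exact zpow_le_zpow_right₀ one_le_two (by omega)
  · refine w.eq_zero_of_lt ((div_lt_iff₀ (hpos n)).2 (hm2.trans_le ?_))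
    have : (2 : ℝ) ^ (m + 1) ≤ 2 ^ (n - 1) := zpow_le_zpow_right₀ one_le_two (by omega)
    rw [zpow_sub_one₀ two_ne_zero] at this
    linarith

theorem fourier_lpKernel (w : DyadicBump) (n : ℤ) (ξ : EuclideanSpace ℝ (Fin d)) :
    𝓕 (lpKernel (d := d) w n) ξ = lpSymbolFun w n ξ := by
  simp [lpKernel]

theorem lpSymbolFun_zero_smul (w : DyadicBump) (n : ℤ) (ξ : EuclideanSpace ℝ (Fin d)) :
    lpSymbolFun w n ξ = lpSymbolFun w 0 (((2 : ℝ) ^ n)⁻¹ • ξ) := by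
  have h : (0 : ℝ) < 2 ^ n := by positivity
  unfold lpSymbolFun
  rw [smul_comm _ ((2 : ℝ) ^ n)⁻¹, norm_smul ((2 : ℝ) ^ n)⁻¹, norm_inv, Real.norm_of_nonneg h.le]
  simp only [zpow_zero, div_one]
  rw [inv_mul_eq_div]

/-- Dilating the symbol dilates the kernel in an `L¹`-preserving way, so all the kernels have the
same `L¹` norm. -/
theorem lpKernel_apply (w : DyadicBump) (n : ℤ) (x : EuclideanSpace ℝ (Fin d)) :
    lpKernel w n x = ((2 : ℝ) ^ n) ^ d • lpKernel w 0 ((2 : ℝ) ^ n • x) := by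
  have h : (0 : ℝ) < 2 ^ n := by positivity
  have key : ∀ m : ℤ, ∀ y : EuclideanSpace ℝ (Fin d), lpKernel w m y =
      ∫ ξ, Real.fourierChar (inner ℝ ξ y) • lpSymbolFun w m ξ := by
    intro m y
    rw [lpKernel, SchwartzMap.fourierInv_coe, Real.fourierInv_eq]
    rfl
  rw [key, key]
  have := Measure.integral_comp_smul volume
    (fun ξ : EuclideanSpace ℝ (Fin d) =>
      Real.fourierChar (inner ℝ ξ ((2 : ℝ) ^ n • x)) • lpSymbolFun w 0 ξ) ((2 : ℝ) ^ n)⁻¹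
  simp only [← lpSymbolFun_zero_smul, real_inner_smul_left, real_inner_smul_right,
    mul_inv_cancel_left₀ h.ne', finrank_euclideanSpace,
    Fintype.card_fin] at this
  rw [abs_of_nonneg (by positivity), inv_pow, inv_inv] at this
  simp only [this, real_inner_smul_right]

theorem integral_norm_lpKernel (w : DyadicBump) (n : ℤ) :
    ∫ x : EuclideanSpace ℝ (Fin d), ‖lpKernel w n x‖ =
      ∫ x : EuclideanSpace ℝ (Fin d), ‖lpKernel w 0 x‖ := by
  have h : (0 : ℝ) < 2 ^ n := by positivity
  have := Measure.integral_comp_smul volume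
    (fun x : EuclideanSpace ℝ (Fin d) => ‖lpKernel w 0 x‖) ((2 : ℝ) ^ n)
  simp_rw [lpKernel_apply w n, norm_smul, integral_const_mul]
  rw [this, finrank_euclideanSpace, Fintype.card_fin, smul_eq_mul, norm_pow, norm_zpow,
    Real.norm_of_nonneg zero_le_two, abs_of_nonneg (by positivity)]
  field_simp

end LittlewoodPaley

/-! ### Besov norms of trigonometric polynomials. -/

section TrigPoly

variable {d : ℕ} {ι : Type*} [Fintype ι]

local notation "E" => EuclideanSpace ℝ (Fin d)

/-- The trigonometric polynomial `∑ c_i e^{2πi(κ_i, x)}`. -/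
def trigPoly (κ : ι → E) (c : ι → ℂ) (x : E) : ℂ :=
  ∑ i, c i * Real.fourierChar (inner ℝ x (κ i))

/-- The tempered distribution given by `e^{2πi(κ, x)}`. -/
def expDist (κ : E) : 𝓢'(E, ℂ) :=
  ContinuousLinearMap.toPointwiseConvergenceCLM _ _ _ _
    ((BoundedContinuousFunction.evalCLM ℂ κ) ∘L (SchwartzMap.toBoundedContinuousFunctionCLM ℂ E ℂ)
      ∘L FourierTransform.fourierInvCLM ℂ 𝓢(E, ℂ))

theorem expDist_apply (κ : E) (u : 𝓢(E, ℂ)) : expDist κ u = 𝓕⁻ u κ := rfl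

/-- The tempered distribution given by a trigonometric polynomial. -/
def trigDist (κ : ι → E) (c : ι → ℂ) : 𝓢'(E, ℂ) := ∑ i, c i • expDist (κ i)

theorem trigDist_apply (κ : ι → E) (c : ι → ℂ) (u : 𝓢(E, ℂ)) :
    trigDist κ c u = ∑ i, c i * 𝓕⁻ u (κ i) := by
  simp [trigDist, expDist_apply]

theorem continuous_trigPoly (κ : ι → E) (c : ι → ℂ) : Continuous (trigPoly κ c) := by
  unfold trigPoly
  fun_prop

theorem norm_trigPoly_le (κ : ι → E) (c : ι → ℂ) (x : E) : ‖trigPoly κ c x‖ ≤ ∑ i, ‖c i‖ :=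
  (norm_sum_le _ _).trans (Finset.sum_le_sum fun i _ => by
    rw [norm_mul, Circle.norm_coe, mul_one])

theorem integrable_mul_trigPoly (κ : ι → E) (c : ι → ℂ) (u : 𝓢(E, ℂ)) :
    Integrable fun x => u x * trigPoly κ c x :=
  u.integrable.mul_bdd (c := ∑ i, ‖c i‖) (continuous_trigPoly κ c).aestronglyMeasurable
    (Filter.Eventually.of_forall (norm_trigPoly_le κ c))

theorem integrable_mul_fourierChar (κ : E) (u : 𝓢(E, ℂ)) :
    Integrable fun x => u x * (Real.fourierChar (inner ℝ x κ) : ℂ) :=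
  u.integrable.mul_bdd (c := 1) (by fun_prop)
    (Filter.Eventually.of_forall fun _ => (Circle.norm_coe _).le)

theorem fourierInv_eq_integral_mul (κ : E) (u : 𝓢(E, ℂ)) :
    𝓕⁻ u κ = ∫ x, u x * (Real.fourierChar (inner ℝ x κ) : ℂ) := by
  rw [SchwartzMap.fourierInv_coe, Real.fourierInv_eq]
  refine integral_congr_ae (Filter.Eventually.of_forall fun x => ?_)
  simp only [Circle.smul_def, smul_eq_mul, mul_comm]

theorem trigDist_apply_eq_integral (κ : ι → E) (c : ι → ℂ) (u : 𝓢(E, ℂ)) :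
    trigDist κ c u = ∫ x, u x * trigPoly κ c x := by
  rw [trigDist_apply]
  simp only [trigPoly, Finset.mul_sum, mul_left_comm (u _)]
  rw [integral_finsetSum _ fun i _ => (integrable_mul_fourierChar (κ i) u).const_mul (c i)]
  simp only [integral_const_mul, fourierInv_eq_integral_mul]

theorem isContinuousRepr_trigDist (κ : ι → E) (c : ι → ℂ) :
    IsContinuousRepr (trigPoly κ c) (trigDist κ c) :=
  ⟨continuous_trigPoly κ c, integrable_mul_trigPoly κ c, trigDist_apply_eq_integral κ c⟩

theorem linftyNorm_trigDist_le (κ : ι → E) (c : ι → ℂ) {b : ℝ}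
    (hb : ∀ x, ‖trigPoly κ c x‖ ≤ b) : linftyNorm (trigDist κ c) ≤ ENNReal.ofReal b := by
  have hmem : MemLp (trigPoly κ c) ⊤ (volume : Measure E) :=
    memLp_top_of_bound (continuous_trigPoly κ c).aestronglyMeasurable b
      (Filter.Eventually.of_forall hb)
  refine (iInf₂_le (hmem.toLp _) ?_).trans ?_
  · ext u
    rw [Lp.toTemperedDistribution_apply, trigDist_apply_eq_integral]
    refine integral_congr_ae ?_
    filter_upwards [hmem.coeFn_toLp] with x hx
    rw [hx, smul_eq_mul]
  · rw [Lp.enorm_toLp]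
    exact (eLpNorm_exponent_top.trans_le
      (eLpNormEssSup_le_of_ae_bound (Filter.Eventually.of_forall hb)))

/-- Exponentials are eigenfunctions of convolution, with eigenvalue `𝓕 W (κ i)`. -/
theorem distConv_trigDist (κ : ι → E) (c : ι → ℂ) (W : 𝓢(E, ℂ)) :
    distConv (trigDist κ c) W = trigDist κ fun i => c i * 𝓕 W (κ i) := by
  ext u
  change trigDist κ c (SchwartzMap.convolution _ _ u) = _
  rw [trigDist_apply, trigDist_apply]
  refine Finset.sum_congr rfl fun i _ => ?_
  have hneg : ∀ g : 𝓢(E, ℂ), 𝓕⁻ g (κ i) = 𝓕 g (-κ i) := fun g => by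
    rw [SchwartzMap.fourierInv_coe, SchwartzMap.fourier_coe, Real.fourierInv_eq_fourier_neg]
  have hW : 𝓕 (SchwartzMap.compCLMOfContinuousLinearEquiv ℂ
      (ContinuousLinearEquiv.neg ℝ : E ≃L[ℝ] E) W) (-κ i) = 𝓕 W (κ i) := by
    rw [SchwartzMap.fourier_coe, SchwartzMap.fourier_coe,
      SchwartzMap.compCLMOfContinuousLinearEquiv_apply]
    have h := congrFun (Real.fourierInv_eq_fourier_comp_neg (W : E → ℂ)) (-κ i)
    rw [Real.fourierInv_eq_fourier_neg, neg_neg] at h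
    exact h.symm
  rw [hneg, hneg, SchwartzMap.fourier_convolution, SchwartzMap.pairing_apply_apply, hW,
    ContinuousLinearMap.mul_apply', mul_assoc]

theorem trigPoly_mul_fourier (κ : ι → E) (c : ι → ℂ) (W : 𝓢(E, ℂ)) (x : E) :
    trigPoly κ (fun i => c i * 𝓕 W (κ i)) x = ∫ y, W y * trigPoly κ c (x - y) := by
  have hint : ∀ i, Integrable fun y : E =>
      c i * (W y * (Real.fourierChar (inner ℝ (x - y) (κ i)) : ℂ)) := fun i =>
    (W.integrable.mul_bdd (c := 1) (by fun_prop)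
    (Filter.Eventually.of_forall fun _ => (Circle.norm_coe _).le)).const_mul _
  simp only [trigPoly, Finset.mul_sum, mul_left_comm (W _)]
  rw [integral_finsetSum _ fun i _ => hint i]
  refine Finset.sum_congr rfl fun i _ => ?_
  rw [integral_const_mul, mul_assoc, SchwartzMap.fourier_coe, Real.fourier_eq,
    ← integral_mul_const]
  congr 1
  refine integral_congr_ae (Filter.Eventually.of_forall fun y => ?_)
  simp only [Circle.smul_def, smul_eq_mul, sub_eq_neg_add, inner_add_left, inner_neg_left,
    AddChar.map_add_eq_mul, Circle.coe_mul]
  ring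

theorem norm_trigPoly_mul_fourier_le (κ : ι → E) (c : ι → ℂ) (W : 𝓢(E, ℂ)) {b : ℝ}
    (hb : ∀ x, ‖trigPoly κ c x‖ ≤ b) (x : E) :
    ‖trigPoly κ (fun i => c i * 𝓕 W (κ i)) x‖ ≤ (∫ y, ‖W y‖) * b := by
  rw [trigPoly_mul_fourier, ← integral_mul_const]
  refine norm_integral_le_of_norm_le (W.integrable.norm.mul_const b)
    (Filter.Eventually.of_forall fun y => ?_)
  rw [norm_mul]
  exact mul_le_mul_of_nonneg_left (hb _) (norm_nonneg _)

theorem fourierInv_lineDeriv_zero (v : E) (u : 𝓢(E, ℂ)) : 𝓕⁻ (∂_{v} u) (0 : E) = 0 := by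
  have h : (fun x : E => inner ℝ x v).HasTemperateGrowth := by fun_prop
  rw [SchwartzMap.fourierInv_lineDerivOp_eq, smul_apply,
    SchwartzMap.smulLeftCLM_apply_apply h]
  simp

theorem hasSum_lpSymbolFun (w : DyadicBump) {κ : E} (hκ : κ ≠ 0) :
    HasSum (fun n : ℤ => lpSymbolFun w n κ) 1 := by
  have h : 0 < ‖(2 * Real.pi) • κ‖ := norm_pos_iff.2 (smul_ne_zero (by positivity) hκ)
  exact_mod_cast (w.hasSum_zpow h).mapL Complex.ofRealCLM

theorem hasSum_lineDeriv_trigDist (w : DyadicBump) (κ : ι → E) (c : ι → ℂ) (v : E) :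
    HasSum (fun n : ℤ => ∂_{v} (distConv (trigDist κ c) (lpKernel w n)))
      (∂_{v} (trigDist κ c)) := by
  refine PointwiseConvergenceCLM.tendsto_iff_forall_tendsto.2 fun u => ?_
  have main : HasSum (fun n : ℤ => ∂_{v} (distConv (trigDist κ c) (lpKernel w n)) u)
      (∂_{v} (trigDist κ c) u) := by
    simp only [distConv_trigDist, fourier_lpKernel, TemperedDistribution.lineDerivOp_apply_apply,
      map_neg, trigDist_apply]
    refine HasSum.neg (hasSum_sum fun i _ => ?_)
    -- The dyadic pieces lose the constant term, since every symbol vanishes at 0; differentiation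
    -- removes it from both sides.
    rcases eq_or_ne (κ i) 0 with h | h
    · simp only [h, fourierInv_lineDeriv_zero, mul_zero]
      exact hasSum_zero
    · simpa using ((hasSum_lpSymbolFun w h).mul_left (c i)).mul_right (𝓕⁻ (∂_{v} u) (κ i))
  simpa [HasSum] using main

/-- A bound for the norm of `B^1_{∞,1}` of functions that are bounded by `1` and have
spectrum in a ball of radius at most `2^N / (4π)`. -/
def besovBound (d : ℕ) (w : DyadicBump) (N : ℤ) : ℝ≥0∞ :=
  ∑' n : ℤ, if n ≤ N then
    (2 : ℝ≥0∞) ^ n * ENNReal.ofReal (∫ x : EuclideanSpace ℝ (Fin d), ‖lpKernel w 0 x‖) else 0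

theorem besovBound_ne_top (w : DyadicBump) (N : ℤ) : besovBound d w N ≠ ⊤ := by
  have hinj : Function.Injective fun k : ℕ => N - (k : ℤ) := fun a b h => by
    simpa using h
  unfold besovBound
  -- With `n = N - k` the sum becomes a geometric series over `k : ℕ`.
  rw [← hinj.tsum_eq]
  · have h : ∀ k : ℕ, (2 : ℝ≥0∞) ^ (N - (k : ℤ)) = 2 ^ N * 2⁻¹ ^ k := by
      intro k
      rw [ENNReal.zpow_sub (by simp) (by simp), zpow_natCast, ENNReal.inv_pow]
    simp only [sub_le_self_iff, Nat.cast_nonneg, if_true, h, mul_right_comm _ ((2⁻¹ : ℝ≥0∞) ^ _)]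
    rw [ENNReal.tsum_mul_left, ENNReal.tsum_geometric]
    refine ENNReal.mul_ne_top (ENNReal.mul_ne_top ?_ ENNReal.ofReal_ne_top) (by simp)
    exact (ENNReal.zpow_lt_top (by simp) (by simp) N).ne
  · intro n hn
    have : n ≤ N := by
      by_contra h
      simp [h] at hn
    exact ⟨(N - n).toNat, by simp; omega⟩

/-- For `n ≤ N`, convolution with the kernel costs at most its `L¹` norm. For `n > N`, the symbol
vanishes at every frequency. No lower bound on the frequencies is needed, as the weights `2^n` are
summable at `-∞`. -/
theorem besovNorm_trigDist_le (w : DyadicBump) {N : ℤ} {κ : ι → E} {c : ι → ℂ}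
    (hκ : ∀ i, ‖(2 * Real.pi) • κ i‖ ≤ 2 ^ N / 2) (hc : ∀ x, ‖trigPoly κ c x‖ ≤ 1) :
    besovNorm w (trigDist κ c) ≤ besovBound d w N := by
  refine ENNReal.tsum_le_tsum fun n => ?_
  rw [distConv_trigDist]
  split_ifs with h
  · gcongr
    refine linftyNorm_trigDist_le _ _ fun x => ?_
    refine (norm_trigPoly_mul_fourier_le κ c _ hc x).trans_eq ?_
    rw [mul_one, integral_norm_lpKernel]
  · have h0 : ∀ i, c i * 𝓕 (lpKernel (d := d) w n) (κ i) = 0 := by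
      intro i
      rw [fourier_lpKernel, lpSymbolFun, w.eq_zero_of_lt]
      · simp
      · have h1 : (2 : ℝ) ^ N < 2 ^ n := zpow_lt_zpow_right₀ one_lt_two (by omega)
        rw [div_lt_iff₀ (by positivity)]
        linarith [hκ i]
    simp only [h0]
    have := linftyNorm_trigDist_le (b := 0) κ (fun _ => (0 : ℂ)) (by simp [trigPoly])
    rw [ENNReal.ofReal_zero, nonpos_iff_eq_zero] at this
    rw [this, mul_zero]

theorem memBesov_trigDist (w : DyadicBump) {N : ℤ} {κ : ι → E} {c : ι → ℂ}
    (hκ : ∀ i, ‖(2 * Real.pi) • κ i‖ ≤ 2 ^ N / 2) (hc : ∀ x, ‖trigPoly κ c x‖ ≤ 1) :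
    MemBesov w (trigDist κ c) :=
  ⟨((besovNorm_trigDist_le w hκ hc).trans_lt (besovBound_ne_top w N).lt_top).ne,
    fun _ => hasSum_lineDeriv_trigDist w κ c _⟩

end TrigPoly

/-! ### Operators diagonal in a finite orthonormal family. -/

section Diagonal

open InnerProductSpace

variable {H : Type*} [NormedAddCommGroup H] [InnerProductSpace ℂ H] {ι : Type*} [Fintype ι]

/-- The operator `∑ a_i (·, v_i) v_i`. -/
def diagOp (v : ι → H) (a : ι → ℝ) : H →L[ℂ] H := ∑ i, (a i : ℂ) • rankOne ℂ (v i) (v i)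

/-- The spectral projections of `diagOp v a`; `none` corresponds to the eigenvalue `0`. -/
def diagProj (v : ι → H) : Option ι → H →L[ℂ] H
  | none => 1 - ∑ i, rankOne ℂ (v i) (v i)
  | some i => rankOne ℂ (v i) (v i)

theorem diagOp_apply (v : ι → H) (a : ι → ℝ) (x : H) :
    diagOp v a x = ∑ i, (a i : ℂ) • inner ℂ (v i) x • v i := by
  simp [diagOp]

theorem diagOp_sub (v : ι → H) (a b : ι → ℝ) : diagOp v a - diagOp v b = diagOp v (a - b) := by
  simp [diagOp, ← Finset.sum_sub_distrib, sub_smul]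

theorem range_diagOp_le (v : ι → H) (a : ι → ℝ) :
    LinearMap.range (diagOp v a : H →ₗ[ℂ] H) ≤ Submodule.span ℂ (Set.range v) := by
  rintro _ ⟨x, rfl⟩
  rw [ContinuousLinearMap.coe_coe, diagOp_apply]
  exact Submodule.sum_mem _ fun i _ => Submodule.smul_mem _ _ (Submodule.smul_mem _ _
    (Submodule.subset_span ⟨i, rfl⟩))

theorem rank_diagOp_le (v : ι → H) (a : ι → ℝ) :
    LinearMap.rank (diagOp v a : H →ₗ[ℂ] H) ≤ (Fintype.card ι : Cardinal) := by
  have : Module.Finite ℂ (Submodule.span ℂ (Set.range v)) :=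
    FiniteDimensional.span_of_finite ℂ (Set.finite_range v)
  refine (Submodule.rank_mono (range_diagOp_le v a)).trans ?_
  rw [← Module.finrank_eq_rank]
  exact_mod_cast finrank_range_le_card v

theorem rankOne_mul_rankOne_orthonormal {κ : Type*} [DecidableEq κ] {v : κ → H}
    (hv : Orthonormal ℂ v) (i j : κ) : rankOne ℂ (v i) (v i) * rankOne ℂ (v j) (v j) =
      if i = j then rankOne ℂ (v i) (v i) else 0 := by
  rw [ContinuousLinearMap.mul_def, rankOne_comp_rankOne, orthonormal_iff_ite.1 hv]
  split_ifs with h <;> simp [h]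

variable [CompleteSpace H]

theorem isFiniteRankSelfAdjoint_diagOp (v : ι → H) (a : ι → ℝ) :
    IsFiniteRankSelfAdjoint (diagOp v a) where
  isSelfAdjoint := by
    refine isSelfAdjoint_sum _ fun i _ => ?_
    rw [IsSelfAdjoint, star_smul, ContinuousLinearMap.star_eq_adjoint, adjoint_rankOne]
    simp
  finiteRank := by
    have : Module.Finite ℂ (Submodule.span ℂ (Set.range v)) :=
      FiniteDimensional.span_of_finite ℂ (Set.finite_range v)
    exact Submodule.finiteDimensional_of_le (range_diagOp_le v a)

theorem isStarProjection_sum_rankOne {v : ι → H} (hv : Orthonormal ℂ v) :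
    IsStarProjection (∑ i, rankOne ℂ (v i) (v i)) := by
  classical
  refine ⟨?_, ?_⟩
  · simp [IsIdempotentElem, Finset.sum_mul_sum, rankOne_mul_rankOne_orthonormal hv]
  · refine isSelfAdjoint_sum _ fun i _ => ?_
    rw [IsSelfAdjoint, ContinuousLinearMap.star_eq_adjoint, adjoint_rankOne]

/-- The orthogonal complement of the family carries the eigenvalue 0, so the `a i` must avoid 0 for
the eigenvalues to be distinct. -/
theorem isSpectralResolution_diagOp {v : ι → H} (hv : Orthonormal ℂ v) {a : ι → ℝ}
    (ha : Function.Injective a) (ha0 : ∀ i, a i ≠ 0) :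
    IsSpectralResolution (diagOp v a) (diagProj v) (fun o => o.elim 0 a) := by
  classical
  have hmul := rankOne_mul_rankOne_orthonormal hv
  constructor
  · rintro (_ | i)
    · exact (isStarProjection_sum_rankOne hv).one_sub
    · exact isStarProjection_rankOne_self (hv.1 i)
  · rintro (_ | i) (_ | j) hij
    · exact absurd rfl hij
    · simp [diagProj, sub_mul, Finset.sum_mul, hmul]
    · simp [diagProj, mul_sub, Finset.mul_sum, hmul]
    · have : i ≠ j := fun h => hij (by rw [h])
      simp [diagProj, hmul, this]
  · simp [Fintype.sum_option, diagProj]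
  · rintro (_ | i) (_ | j) hij
    · rfl
    · exact absurd hij.symm (ha0 j)
    · exact absurd hij (ha0 i)
    · exact congrArg some (ha hij)
  · simp [Fintype.sum_option, diagProj, diagOp]

theorem norm_diagOp_const_le {v : ι → H} (hv : Orthonormal ℂ v) (a : ℝ) :
    ‖diagOp v fun _ => a‖ ≤ |a| := by
  have h : diagOp v (fun _ => a) = (a : ℂ) • ∑ i, rankOne ℂ (v i) (v i) := by
    simp [diagOp, Finset.smul_sum]
  obtain ⟨K, _, hK⟩ := isStarProjection_iff_eq_starProjection.1 (isStarProjection_sum_rankOne hv)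
  rw [h, norm_smul, hK]
  simpa using mul_le_mul_of_nonneg_left (K.starProjection_norm_le) (abs_nonneg a)

/-- By `hqe` and `heq` the two families span the same space, so the projections onto the complements
contribute nothing on `q k`. -/
theorem tripleFun_diagOp_apply {q e : ι → H} (hq : Orthonormal ℂ q) (he : Orthonormal ℂ e)
    (hqe : ∀ k, ∑ m, inner ℂ (e m) (q k) • e m = q k)
    (heq : ∀ m, ∑ j, inner ℂ (q j) (e m) • q j = e m) {a b : ι → ℝ}
    (ha : Function.Injective a) (ha0 : ∀ i, a i ≠ 0) (hb : Function.Injective b)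
    (hb0 : ∀ i, b i ≠ 0) (f : EuclideanSpace ℝ (Fin 3) → ℂ) (k : ι) :
    tripleFun f (diagOp q a) (diagOp e b) (diagOp q a) (q k) =
      ∑ j, (∑ m, f !₂[a j, b m, a k] * (inner ℂ (e m) (q k) * inner ℂ (q j) (e m))) • q j := by
  classical
  have hA := isSpectralResolution_diagOp hq ha ha0
  have hB := isSpectralResolution_diagOp he hb hb0
  have hPq : ∀ i, diagProj q (some i) (q k) = if i = k then q k else 0 := by
    intro i
    simp only [diagProj, rankOne_apply, orthonormal_iff_ite.1 hq]
    split_ifs with h <;> simp [h]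
  have hPq0 : diagProj q none (q k) = 0 := by
    simp [diagProj, orthonormal_iff_ite.1 hq]
  have hQ0 : diagProj e none (q k) = 0 := by
    simp [diagProj, hqe]
  have hP0 : ∀ m, diagProj q none (e m) = 0 := by
    intro m
    simp [diagProj, heq]
  have hQ : ∀ m, diagProj e (some m) (q k) = inner ℂ (e m) (q k) • e m := fun m => rfl
  have hP : ∀ j m, diagProj q (some j) (e m) = inner ℂ (q j) (e m) • q j := fun j m => rfl
  have hite : ∀ i : ι, ∀ S : H →L[ℂ] H,
      S (if i = k then q k else 0) = if i = k then S (q k) else 0 := by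
    intro i S
    split_ifs <;> simp
  rw [tripleFun_eq_sum hA hB hA]
  simp only [Fintype.sum_option, sum_apply, add_apply, smul_apply,
    mul_apply_eq_comp, hPq, hPq0, hite, hQ0, hQ,
    map_zero, map_smul, hP0, hP, smul_zero, smul_ite, Finset.sum_ite_eq', Finset.mem_univ, if_true,
    zero_add, ite_self, Finset.sum_const_zero, Option.elim, Finset.sum_smul, smul_smul]

end Diagonal

/-! ### The discrete Fourier transform of an orthonormal family. -/

section DFT

open ZMod

theorem ofReal_sqrt_natCast_mul_self (M : ℕ) : (√(M : ℝ) : ℂ) * (√(M : ℝ) : ℂ) = M := by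
  rw [← Complex.ofReal_mul, Real.mul_self_sqrt (Nat.cast_nonneg M)]
  simp

theorem ofReal_sqrt_natCast_inv_mul_self (M : ℕ) :
    (√(M : ℝ) : ℂ)⁻¹ * (√(M : ℝ) : ℂ)⁻¹ = (M : ℂ)⁻¹ := by
  rw [← mul_inv, ofReal_sqrt_natCast_mul_self]

variable {M : ℕ} [NeZero M]

theorem sum_stdAddChar_mul (b : ZMod M) :
    ∑ x : ZMod M, stdAddChar (x * b) = if b = 0 then (M : ℂ) else 0 := by
  rw [AddChar.sum_mulShift b (isPrimitive_stdAddChar M), ZMod.card]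
  split_ifs <;> simp

variable {H : Type*} [NormedAddCommGroup H] [InnerProductSpace ℂ H]

/-- The image of a family of vectors under the discrete Fourier transform. -/
def dftFamily (e : ZMod M → H) (k : ZMod M) : H :=
  (√(M : ℝ) : ℂ)⁻¹ • ∑ m, stdAddChar (k * m) • e m

theorem inner_dftFamily {e : ZMod M → H} (he : Orthonormal ℂ e) (m k : ZMod M) :
    inner ℂ (e m) (dftFamily e k) = (√(M : ℝ) : ℂ)⁻¹ * stdAddChar (k * m) := by
  rw [dftFamily, inner_smul_right, he.inner_right_fintype]

theorem dftFamily_inner {e : ZMod M → H} (he : Orthonormal ℂ e) (j m : ZMod M) :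
    inner ℂ (dftFamily e j) (e m) = (√(M : ℝ) : ℂ)⁻¹ * stdAddChar (-(j * m)) := by
  rw [← inner_conj_symm, inner_dftFamily he, map_mul, AddChar.map_neg_eq_conj]
  simp

theorem orthonormal_dftFamily {e : ZMod M → H} (he : Orthonormal ℂ e) :
    Orthonormal ℂ (dftFamily e) := by
  have hM : (M : ℂ) ≠ 0 := Nat.cast_ne_zero.2 (NeZero.ne M)
  rw [orthonormal_iff_ite]
  intro i j
  have h : ∀ m : ZMod M, stdAddChar (-(i * m)) * stdAddChar (j * m) =
      (stdAddChar (m * (j - i)) : ℂ) := by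
    intro m
    rw [← AddChar.map_add_eq_mul]
    ring_nf
  conv_lhs => rw [dftFamily.eq_def e j]
  rw [inner_smul_right, inner_sum]
  simp only [inner_smul_right, dftFamily_inner he]
  simp only [mul_left_comm _ ((√(M : ℝ) : ℂ)⁻¹), ← Finset.mul_sum]
  simp only [mul_comm (stdAddChar (j * _)), h, sum_stdAddChar_mul]
  rw [← mul_assoc, ofReal_sqrt_natCast_inv_mul_self]
  by_cases hij : i = j
  · simp [hij, hM]
  · simp [hij, sub_eq_zero, Ne.symm hij]

theorem sum_inner_smul_dftFamily {e : ZMod M → H} (he : Orthonormal ℂ e) (k : ZMod M) :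
    ∑ m, inner ℂ (e m) (dftFamily e k) • e m = dftFamily e k := by
  simp only [inner_dftFamily he, mul_smul, ← Finset.smul_sum]
  rfl

theorem sum_dftFamily_inner_smul {e : ZMod M → H} (he : Orthonormal ℂ e) (m : ZMod M) :
    ∑ j, inner ℂ (dftFamily e j) (e m) • dftFamily e j = e m := by
  have hM : (M : ℂ) ≠ 0 := Nat.cast_ne_zero.2 (NeZero.ne M)
  simp only [dftFamily_inner he]
  simp only [dftFamily, smul_smul, Finset.smul_sum]
  rw [Finset.sum_comm]
  have h : ∀ n j : ZMod M, (√(M : ℝ) : ℂ)⁻¹ * stdAddChar (-(j * m)) *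
      ((√(M : ℝ) : ℂ)⁻¹ * stdAddChar (j * n)) = (M : ℂ)⁻¹ * stdAddChar (j * (n - m)) := by
    intro n j
    rw [mul_mul_mul_comm, ofReal_sqrt_natCast_inv_mul_self, ← AddChar.map_add_eq_mul]
    ring_nf
  simp only [h, ← Finset.sum_smul, ← Finset.mul_sum, sum_stdAddChar_mul]
  rw [Fintype.sum_eq_single m]
  · simp [hM]
  · intro n hn
    simp [sub_eq_zero, hn]

end DFT

/-! ### Fejér interpolation and the extremal function `chirp`. -/

section Fejer

open ZMod

theorem fourierChar_intCast_div (M : ℕ) [NeZero M] (n : ℤ) :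
    (Real.fourierChar ((n : ℝ) / M) : ℂ) = stdAddChar (n : ZMod M) := by
  rw [stdAddChar_coe, Real.fourierChar_apply]
  congr 1
  push_cast
  ring

theorem fourierChar_mul_div {M : ℕ} [NeZero M] (x y : ZMod M) {s t : ℤ} (hs : (s : ZMod M) = x)
    (ht : (t : ZMod M) = y) : (Real.fourierChar ((s : ℝ) * t / M) : ℂ) = stdAddChar (x * y) := by
  have := fourierChar_intCast_div M (s * t)
  push_cast at this
  rw [this, hs, ht]

theorem fourierChar_add (s t : ℝ) :
    (Real.fourierChar (s + t) : ℂ) = Real.fourierChar s * Real.fourierChar t := by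
  rw [AddChar.map_add_eq_mul, Circle.coe_mul]

theorem fourierChar_natCast (n : ℕ) : (Real.fourierChar (n : ℝ) : ℂ) = 1 := by
  rw [Real.fourierChar_apply, Complex.exp_eq_one_iff]
  exact ⟨n, by push_cast; ring⟩

/-- The Fejér kernel of period `M`, normalized by the value `1` at `0`. -/
def fejer (M : ℕ) [NeZero M] (t : ℝ) : ℂ :=
  ∑ p : ZMod M × ZMod M,
    ((M : ℂ) ^ 2)⁻¹ * Real.fourierChar (((p.1.val : ℝ) - p.2.val) * t / M)

variable {M : ℕ} [NeZero M]

/-- The kernel is the squared modulus of a Dirichlet-type sum, hence real and nonnegative. -/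
theorem fejer_eq_mul_conj (t : ℝ) :
    fejer M t = ((M : ℂ) ^ 2)⁻¹ *
      ((∑ l : ZMod M, (Real.fourierChar ((l.val : ℝ) * t / M) : ℂ)) *
        starRingEnd ℂ (∑ l : ZMod M, (Real.fourierChar ((l.val : ℝ) * t / M) : ℂ))) := by
  rw [map_sum, Fintype.sum_mul_sum, Finset.mul_sum, fejer, Fintype.sum_prod_type]
  refine Finset.sum_congr rfl fun l _ => ?_
  rw [Finset.mul_sum]
  refine Finset.sum_congr rfl fun l' _ => ?_
  rw [← Circle.coe_inv_eq_conj, ← AddChar.map_neg_eq_inv, ← fourierChar_add]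
  congr 3
  ring

theorem ofReal_norm_fejer (t : ℝ) : ((‖fejer M t‖ : ℝ) : ℂ) = fejer M t := by
  rw [fejer_eq_mul_conj, Complex.mul_conj, norm_mul, norm_inv, norm_pow, Complex.norm_natCast,
    Complex.norm_of_nonneg (Complex.normSq_nonneg _)]
  push_cast
  rfl

/-- Summing over the shifts leaves, by orthogonality of characters, only the `M` pairs with `p.1 =
p.2`, each contributing `M⁻² · M`. With positivity this turns the translates into a partition of
unity. -/
theorem sum_fejer_sub (t : ℝ) : ∑ j : ZMod M, fejer M (t - (j.val + 1)) = 1 := by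
  have hM : (M : ℂ) ≠ 0 := Nat.cast_ne_zero.2 (NeZero.ne M)
  unfold fejer
  rw [Finset.sum_comm]
  have h : ∀ (p : ZMod M × ZMod M) (j : ZMod M),
      ((M : ℂ) ^ 2)⁻¹ * (Real.fourierChar (((p.1.val : ℝ) - p.2.val) * (t - (j.val + 1)) / M) : ℂ) =
      ((M : ℂ) ^ 2)⁻¹ * Real.fourierChar (((p.1.val : ℝ) - p.2.val) * (t - 1) / M) *
        stdAddChar (j * (p.2 - p.1)) := by
    intro p j
    rw [← fourierChar_mul_div (s := j.val) (t := p.2.val - p.1.val) j (p.2 - p.1) (by simp)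
      (by simp), mul_assoc, ← fourierChar_add]
    push_cast
    congr 3
    ring
  simp only [h, ← Finset.mul_sum, sum_stdAddChar_mul]
  rw [Fintype.sum_prod_type]
  simp only [sub_eq_zero, mul_ite, mul_zero, Finset.sum_ite_eq', Finset.mem_univ, if_true, sub_self,
    zero_mul, zero_div, AddChar.map_zero_eq_one, Circle.coe_one, Finset.sum_const, Finset.card_univ,
    ZMod.card, nsmul_eq_mul]
  field_simp

theorem sum_norm_fejer_sub (t : ℝ) : ∑ j : ZMod M, ‖fejer M (t - (j.val + 1))‖ = 1 := by
  have h : ((∑ j : ZMod M, ‖fejer M (t - (j.val + 1))‖ : ℝ) : ℂ) = 1 := by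
    push_cast
    simp only [ofReal_norm_fejer, sum_fejer_sub]
  exact_mod_cast h

theorem fejer_val_sub (i j : ZMod M) :
    fejer M ((i.val + 1 : ℝ) - (j.val + 1)) = if i = j then 1 else 0 := by
  have hM : (M : ℂ) ≠ 0 := Nat.cast_ne_zero.2 (NeZero.ne M)
  have h : ∀ l : ZMod M, (Real.fourierChar ((l.val : ℝ) * ((i.val + 1 : ℝ) - (j.val + 1)) / M) : ℂ) =
      stdAddChar (l * (i - j)) := by
    intro l
    rw [← fourierChar_mul_div (s := l.val) (t := i.val - j.val) l (i - j) (by simp) (by simp)]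
    push_cast
    congr 3
    ring
  rw [fejer_eq_mul_conj]
  simp only [h, sum_stdAddChar_mul, sub_eq_zero]
  split_ifs
  · simp
    field_simp
  · simp

/-- A function bounded by `1` with frequencies in a fixed bounded set, which behaves badly on the
points `(i, m, k)` with integer coordinates between `1` and `M`. -/
def chirp (M : ℕ) [NeZero M] (x : EuclideanSpace ℝ (Fin 3)) : ℂ :=
  ∑ j : ZMod M, ∑ k : ZMod M, fejer M (x 0 - (j.val + 1)) * fejer M (x 2 - (k.val + 1)) *
    -- The exact differences of representatives keep the frequency in `[-1, 1]`, whereas `χ(jk)` is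
    -- a constant coefficient and costs no frequency.
    (stdAddChar (j * k) * Real.fourierChar (((j.val : ℝ) - k.val) * (x 1 - 1) / M) *
      ((1 + Real.fourierChar (x 1)) / 2))

theorem norm_stdAddChar (j : ZMod M) : ‖(stdAddChar j : ℂ)‖ = 1 := by
  rw [stdAddChar_apply, Circle.norm_coe]

/-- At each point the value is an average of numbers of modulus at most 1, with the products of the
Fejér weights as coefficients. -/
theorem norm_chirp_le (x : EuclideanSpace ℝ (Fin 3)) : ‖chirp M x‖ ≤ 1 := by
  have h2 : ‖(1 + (Real.fourierChar (x 1) : ℂ)) / 2‖ ≤ 1 := by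
    rw [norm_div, Complex.norm_ofNat, div_le_one two_pos]
    refine (norm_add_le _ _).trans ?_
    rw [norm_one, Circle.norm_coe]
    norm_num
  calc ‖chirp M x‖ ≤ ∑ j : ZMod M, ∑ k : ZMod M,
        ‖fejer M (x 0 - (j.val + 1))‖ * ‖fejer M (x 2 - (k.val + 1))‖ := by
        refine (norm_sum_le _ _).trans (Finset.sum_le_sum fun j _ =>
          (norm_sum_le _ _).trans (Finset.sum_le_sum fun k _ => ?_))
        rw [norm_mul, norm_mul, norm_mul, norm_mul, norm_stdAddChar, Circle.norm_coe, one_mul,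
          one_mul]
        exact mul_le_of_le_one_right (by positivity) h2
    _ = 1 := by rw [← Fintype.sum_mul_sum, sum_norm_fejer_sub, sum_norm_fejer_sub, one_mul]

/-- The index set of the Fourier expansion of `chirp M`. -/
abbrev ChirpIndex (M : ℕ) : Type :=
  ZMod M × ZMod M × (ZMod M × ZMod M) × (ZMod M × ZMod M) × Fin 2

/-- The frequencies of `chirp M`. -/
def chirpFreq (M : ℕ) : ChirpIndex M → EuclideanSpace ℝ (Fin 3)
  | (j, k, p, r, s) => !₂[((p.1.val : ℝ) - p.2.val) / M, ((j.val : ℝ) - k.val) / M + (s : ℕ),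
      ((r.1.val : ℝ) - r.2.val) / M]

/-- The Fourier coefficients of `chirp M`. -/
def chirpCoeff (M : ℕ) [NeZero M] : ChirpIndex M → ℂ
  | (j, k, p, r, _) =>
    ((M : ℂ) ^ 2)⁻¹ * Real.fourierChar (-(((p.1.val : ℝ) - p.2.val) * (j.val + 1) / M)) *
      (((M : ℂ) ^ 2)⁻¹ * Real.fourierChar (-(((r.1.val : ℝ) - r.2.val) * (k.val + 1) / M))) *
      (stdAddChar (j * k) * Real.fourierChar (-(((j.val : ℝ) - k.val) / M)) * (1 / 2))

theorem chirp_eq_trigPoly : chirp M = trigPoly (chirpFreq M) (chirpCoeff M) := by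
  funext x
  unfold trigPoly chirp
  rw [Fintype.sum_prod_type]
  refine Finset.sum_congr rfl fun j _ => ?_
  rw [Fintype.sum_prod_type]
  refine Finset.sum_congr rfl fun k _ => ?_
  rw [Fintype.sum_prod_type, fejer, fejer, Fintype.sum_mul_sum, Finset.sum_mul]
  refine Finset.sum_congr rfl fun p _ => ?_
  rw [Finset.sum_mul]
  refine Eq.trans ?_ (Fintype.sum_prod_type _).symm
  refine Finset.sum_congr rfl fun r _ => ?_
  have hin : ∀ s : Fin 2, inner ℝ x (chirpFreq M (j, k, p, r, s)) =
      (((p.1.val : ℝ) - p.2.val) * x 0 / M + ((r.1.val : ℝ) - r.2.val) * x 2 / M) +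
        (((j.val : ℝ) - k.val) * x 1 / M + (s : ℕ) * x 1) := by
    intro s
    simp only [chirpFreq, PiLp.inner_apply, Fin.sum_univ_three]
    simp
    ring
  have hp : ((p.1.val : ℝ) - p.2.val) * (x 0 - (j.val + 1)) / M =
      ((p.1.val : ℝ) - p.2.val) * x 0 / M + -(((p.1.val : ℝ) - p.2.val) * (j.val + 1) / M) := by
    ring
  have hr : ((r.1.val : ℝ) - r.2.val) * (x 2 - (k.val + 1)) / M =
      ((r.1.val : ℝ) - r.2.val) * x 2 / M + -(((r.1.val : ℝ) - r.2.val) * (k.val + 1) / M) := by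
    ring
  have hj : ((j.val : ℝ) - k.val) * (x 1 - 1) / M =
      ((j.val : ℝ) - k.val) * x 1 / M + -(((j.val : ℝ) - k.val) / M) := by
    ring
  rw [hp, hr, hj, Fin.sum_univ_two, hin, hin]
  simp only [chirpCoeff, fourierChar_add, Fin.val_zero, Fin.val_one, Nat.cast_zero, Nat.cast_one,
    zero_mul, one_mul, AddChar.map_zero_eq_one, Circle.coe_one]
  ring

theorem abs_val_sub_val_div_le (i j : ZMod M) : |((i.val : ℝ) - j.val) / M| ≤ 1 := by
  have hM : (0 : ℝ) < M := Nat.cast_pos.2 (NeZero.pos M)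
  have hi : (i.val : ℝ) < M := by exact_mod_cast i.val_lt
  have hj : (j.val : ℝ) < M := by exact_mod_cast j.val_lt
  have hi0 : (0 : ℝ) ≤ i.val := Nat.cast_nonneg _
  have hj0 : (0 : ℝ) ≤ j.val := Nat.cast_nonneg _
  rw [abs_div, abs_of_pos hM, div_le_one hM, abs_le]
  constructor <;> linarith

theorem norm_chirpFreq_le (i : ChirpIndex M) :
    ‖(2 * Real.pi) • chirpFreq M i‖ ≤ 2 ^ (6 : ℤ) / 2 := by
  obtain ⟨j, k, p, r, s⟩ := i
  have h1 := abs_le.1 (abs_val_sub_val_div_le p.1 p.2)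
  have h2 := abs_le.1 (abs_val_sub_val_div_le j k)
  have h3 := abs_le.1 (abs_val_sub_val_div_le r.1 r.2)
  have hs : ((s : ℕ) : ℝ) ≤ 1 := by exact_mod_cast Nat.lt_succ_iff.1 s.2
  have hs0 : (0 : ℝ) ≤ (s : ℕ) := Nat.cast_nonneg _
  -- The coordinates are bounded by 1, 2 and 1. The exponent 6 then suffices because `2π · 4 ≤ 32 =
  -- 2^6 / 2`.
  have hnorm : ‖chirpFreq M (j, k, p, r, s)‖ ≤ 4 := by
    rw [EuclideanSpace.norm_eq, Real.sqrt_le_left (by norm_num), Fin.sum_univ_three]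
    simp only [chirpFreq, Real.norm_eq_abs, sq_abs, Matrix.cons_val_zero, Matrix.cons_val_one,
      Matrix.cons_val]
    nlinarith
  rw [norm_smul, Real.norm_of_nonneg (by positivity)]
  norm_num
  nlinarith [Real.pi_lt_four, Real.pi_pos, norm_nonneg (chirpFreq M (j, k, p, r, s))]

theorem chirp_apply_val (j m k : ZMod M) :
    chirp M !₂[(j.val + 1 : ℝ), (m.val + 1 : ℝ), (k.val + 1 : ℝ)] =
      stdAddChar (j * k) * stdAddChar ((j - k) * m) := by
  have h1 : (Real.fourierChar ((m.val : ℝ) + 1) : ℂ) = 1 := by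
    exact_mod_cast fourierChar_natCast (m.val + 1)
  have h2 := fourierChar_mul_div (s := j.val - k.val) (t := m.val) (j - k) m (by simp) (by simp)
  push_cast at h2
  unfold chirp
  rw [Fintype.sum_eq_single j, Fintype.sum_eq_single k]
  · simp only [Matrix.cons_val_zero, Matrix.cons_val_one, Matrix.cons_val, fejer_val_sub, h1,
      add_sub_cancel_right, h2]
    norm_num
  · intro k' hk'
    simp only [Matrix.cons_val, fejer_val_sub, if_neg hk'.symm, mul_zero, zero_mul]
  · intro j' hj'
    simp only [Matrix.cons_val_zero, fejer_val_sub, if_neg hj'.symm, zero_mul,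
      Finset.sum_const_zero]

theorem chirp_apply_val_add_half (x z : ℝ) (m : ℕ) :
    chirp M !₂[x, (m + 3 / 2 : ℝ), z] = 0 := by
  have h1 : (Real.fourierChar ((m : ℝ) + 3 / 2) : ℂ) = -1 := by
    have h : (m : ℝ) + 3 / 2 = (m + 1 : ℕ) + 1 / 2 := by
      push_cast
      ring
    rw [h, fourierChar_add, fourierChar_natCast, one_mul, Real.fourierChar_apply,
      ← Complex.exp_pi_mul_I]
    congr 1
    push_cast
    ring
  unfold chirp
  refine Finset.sum_eq_zero fun j _ => Finset.sum_eq_zero fun k _ => ?_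
  simp [h1]

end Fejer

/-! ### The extremal triples and the conclusion. -/

theorem exists_orthonormal_zmod {H : Type*} [NormedAddCommGroup H] [InnerProductSpace ℂ H]
    (hH : ¬ FiniteDimensional ℂ H) (M : ℕ) [NeZero M] : ∃ e : ZMod M → H, Orthonormal ℂ e := by
  have hrank : (M : Cardinal) ≤ Module.rank ℂ H :=
    (Cardinal.natCast_le_aleph0).trans (not_lt.1 fun h => hH (Module.rank_lt_aleph0_iff.1 h))
  obtain ⟨f, hf⟩ := exists_linearIndependent_of_le_rank hrank
  have e : ZMod M ≃ Fin M := Fintype.equivFinOfCardEq (ZMod.card M)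
  exact ⟨_, (InnerProductSpace.gramSchmidtNormed_orthonormal hf).comp e e.injective⟩

/-- For every `M` there are triples of operators whose middle entries differ by half a projection
of rank `M`, while the values of `chirp M` differ by `√M` times a partial isometry of rank `M`. -/
theorem exists_schattenNorm_tripleFun_chirp {H : Type*} [NormedAddCommGroup H]
    [InnerProductSpace ℂ H] [CompleteSpace H] (hH : ¬ FiniteDimensional ℂ H) (M : ℕ) [NeZero M]
    {p : ℝ≥0∞} (hp : 1 ≤ p) :
    ∃ A B₁ B₂ : H →L[ℂ] H, IsFiniteRankSelfAdjoint A ∧ IsFiniteRankSelfAdjoint B₁ ∧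
      IsFiniteRankSelfAdjoint B₂ ∧
      schattenNorm p (B₁ - B₂) ≤ ENNReal.ofReal (1 / 2) * schattenDim p M ∧
      ENNReal.ofReal (√M) * schattenDim p M ≤
        schattenNorm p (tripleFun (chirp M) A B₁ A - tripleFun (chirp M) A B₂ A) := by
  obtain ⟨e, he⟩ := exists_orthonormal_zmod hH M
  have hM : (M : ℂ) ≠ 0 := Nat.cast_ne_zero.2 (NeZero.ne M)
  have hsM : (√(M : ℝ) : ℂ) ≠ 0 := fun h => hM (by
    rw [← ofReal_sqrt_natCast_mul_self, h, zero_mul])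
  set q := dftFamily e with hqdef
  have hq : Orthonormal ℂ q := orthonormal_dftFamily he
  have hinj : ∀ c : ℝ, Function.Injective fun j : ZMod M => (j.val : ℝ) + c := fun c i j h =>
    ZMod.val_injective M (Nat.cast_injective (add_right_cancel h))
  have hpos : ∀ c : ℝ, 0 < c → ∀ j : ZMod M, (j.val : ℝ) + c ≠ 0 := fun c hc j =>
    (add_pos_of_nonneg_of_pos (Nat.cast_nonneg _) hc).ne'
  refine ⟨diagOp q fun j => (j.val : ℝ) + 1, diagOp e fun j => (j.val : ℝ) + 1,
    diagOp e fun j => (j.val : ℝ) + 3 / 2, isFiniteRankSelfAdjoint_diagOp _ _,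
    isFiniteRankSelfAdjoint_diagOp _ _, isFiniteRankSelfAdjoint_diagOp _ _, ?_, ?_⟩
  · have hsub : (diagOp e fun j => (j.val : ℝ) + 1) - (diagOp e fun j => (j.val : ℝ) + 3 / 2) =
        diagOp e fun _ => -(1 / 2) := by
      rw [diagOp_sub]
      congr 1
      funext j
      simp only [Pi.sub_apply]
      ring
    rw [hsub]
    refine (schattenNorm_le_of_rank_le hp
      ((rank_diagOp_le e _).trans_eq (by rw [ZMod.card]))).trans ?_
    gcongr
    rw [← ofReal_norm]
    refine ENNReal.ofReal_le_ofReal ((norm_diagOp_const_le he _).trans_eq ?_)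
    rw [abs_neg, abs_of_pos (by norm_num)]
  -- The difference sends `q k` to `∑ⱼ χ(kj) q j`, which is `√M` times the `k`-th vector of the
  -- Fourier transform of `q`.
  · have h := le_schattenNorm_of_orthonormal (ι := ZMod M) (c := (√(M : ℝ) : ℂ)) hp
      (T := tripleFun (chirp M) (diagOp q fun j => (j.val : ℝ) + 1)
          (diagOp e fun j => (j.val : ℝ) + 1) (diagOp q fun j => (j.val : ℝ) + 1) -
        tripleFun (chirp M) (diagOp q fun j => (j.val : ℝ) + 1)
          (diagOp e fun j => (j.val : ℝ) + 3 / 2) (diagOp q fun j => (j.val : ℝ) + 1))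
      hq (orthonormal_dftFamily hq) ?_
    · refine le_trans (le_of_eq ?_) h
      rw [ZMod.card, ← ofReal_norm, Complex.norm_of_nonneg (Real.sqrt_nonneg _)]
    · intro k
      have happ := fun (c : ℝ) (hc : 0 < c) =>
        tripleFun_diagOp_apply hq he (sum_inner_smul_dftFamily he) (sum_dftFamily_inner_smul he)
          (hinj 1) (hpos 1 one_pos) (hinj c) (hpos c hc) (chirp M) k
      rw [sub_apply, happ 1 one_pos, happ (3 / 2) (by norm_num)]
      simp only [chirp_apply_val, chirp_apply_val_add_half, zero_mul, Finset.sum_const_zero,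
        zero_smul, sub_zero]
      rw [dftFamily, smul_inv_smul₀ hsM]
      refine Finset.sum_congr rfl fun j _ => ?_
      congr 1
      -- The two inner products give `M⁻¹ χ((k - j)m)`, which the phase of `chirp` cancels; the
      -- summand no longer depends on `m`.
      have hterm : ∀ m : ZMod M, ZMod.stdAddChar (j * k) * ZMod.stdAddChar ((j - k) * m) *
          (inner ℂ (e m) (q k) * inner ℂ (q j) (e m)) =
          (M : ℂ)⁻¹ * ZMod.stdAddChar (k * j) := by
        intro m
        rw [hqdef, inner_dftFamily he, dftFamily_inner he, mul_mul_mul_comm (_ : ℂ)⁻¹,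
          ofReal_sqrt_natCast_inv_mul_self, mul_left_comm, ← AddChar.map_add_eq_mul,
          ← AddChar.map_add_eq_mul, ← AddChar.map_add_eq_mul]
        ring_nf
      rw [Finset.sum_congr rfl fun m _ => hterm m, Finset.sum_const, Finset.card_univ, ZMod.card,
        nsmul_eq_mul, mul_inv_cancel_left₀ hM]

end TripleLip

end

theorem theorem4p1 {H : Type*} [NormedAddCommGroup H] [InnerProductSpace ℂ H] [CompleteSpace H]
    (hH : ¬ FiniteDimensional ℂ H) (w : DyadicBump) (p : ℝ≥0∞) (hp : 1 ≤ p) :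
    ¬ ∃ K : ℝ, 0 < K ∧
      ∀ A₁ B₁ C₁ A₂ B₂ C₂ : H →L[ℂ] H,
        IsFiniteRankSelfAdjoint A₁ → IsFiniteRankSelfAdjoint B₁ → IsFiniteRankSelfAdjoint C₁ →
        IsFiniteRankSelfAdjoint A₂ → IsFiniteRankSelfAdjoint B₂ → IsFiniteRankSelfAdjoint C₂ →
        ∀ (f : EuclideanSpace ℝ (Fin 3) → ℂ) (T : 𝓢'(EuclideanSpace ℝ (Fin 3), ℂ)),
          IsContinuousRepr f T → MemBesov w T →
          schattenNorm p (tripleFun f A₁ B₁ C₁ - tripleFun f A₂ B₂ C₂) ≤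
            ENNReal.ofReal K * besovNorm w T *
              max (max (schattenNorm p (A₁ - A₂)) (schattenNorm p (B₁ - B₂)))
                (schattenNorm p (C₁ - C₂)) := by
  rintro ⟨K, -, h⟩
  set X : ℝ≥0∞ := ENNReal.ofReal K * besovBound 3 w 6 * ENNReal.ofReal (1 / 2) with hX
  have hXtop : X ≠ ⊤ :=
    ENNReal.mul_ne_top (ENNReal.mul_ne_top ENNReal.ofReal_ne_top (besovBound_ne_top w 6))
      ENNReal.ofReal_ne_top
  -- `X` does not depend on `M`, so `M = N` contradicts the bound `√M ≤ X`.
  obtain ⟨N, hN⟩ := exists_nat_gt (X.toReal ^ 2)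
  have hbound : ∀ M : ℕ, M ≠ 0 → ENNReal.ofReal (√M) ≤ X := by
    intro M hM0
    have : NeZero M := ⟨hM0⟩
    obtain ⟨A, B₁, B₂, hA, hB₁, hB₂, hle, hge⟩ := exists_schattenNorm_tripleFun_chirp hH M hp
    have hbdd : ∀ x, ‖trigPoly (chirpFreq M) (chirpCoeff M) x‖ ≤ 1 := fun x => by
      rw [← chirp_eq_trigPoly]
      exact norm_chirp_le x
    have hrepr : IsContinuousRepr (chirp M) (trigDist (chirpFreq M) (chirpCoeff M)) := by
      rw [chirp_eq_trigPoly]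
      exact isContinuousRepr_trigDist _ _
    have hmain := h A B₁ A A B₂ A hA hB₁ hA hA hB₂ hA (chirp M) _ hrepr
      (memBesov_trigDist w norm_chirpFreq_le hbdd)
    have h0 : schattenNorm p (A - A) ≤ ENNReal.ofReal (1 / 2) * schattenDim p M := by
      rw [sub_self]
      refine (schattenNorm_le_of_rank_le (m := M) hp (by simp)).trans ?_
      simp [enorm_eq_nnnorm]
    have hchain := (hge.trans hmain).trans
      (mul_le_mul' (mul_le_mul' le_rfl (besovNorm_trigDist_le w norm_chirpFreq_le hbdd))
        (max_le (max_le h0 hle) h0))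
    rw [← mul_assoc, ← hX] at hchain
    -- The only dependence on `p` is the common factor `schattenDim p M`, finite and nonzero.
    exact (ENNReal.mul_le_mul_iff_left (schattenDim_ne_zero p hM0)
      (schattenDim_ne_top p M)).1 hchain
  have hN0 : N ≠ 0 := by
    rintro rfl
    exact absurd hN (not_lt.2 (by simp))
  have hle := (ENNReal.ofReal_le_iff_le_toReal hXtop).1 (hbound N hN0)
  exact absurd ((Real.sqrt_le_left ENNReal.toReal_nonneg).1 hle) (not_le.2 hN)
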